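/- Let $(X,\mathcal B,\mu)$ be a probability space and let $T:X\to X$ be an invertible, bi-measurable, $\mu$-preserving, ergodic transformation which is aperiodic, meaning that for every $n\ge 1$ and every $E\in\mathcal B$ with $\mu(E)>0$ there is a measurable $F\subseteq E$ with $\mu(F\,\triangle\, T^{-n}F)>0$. (If countably many measurable sets separate the points of $X$, as in every standard Borel or Lebesgue space, this says exactly that $\mu$-almost every point $x$ satisfies $T^nx\ne x$ for all $n\ge1$.) Let $A$ be a nonempty finite set, let $(d_n)_{n\in\mathbb N}$ be a sequence of nonnegative integers, and let $\mathbb X=\{X_{n,m}\}_{n\in\mathbb N,\,1\le m\le d_n}$ be an $A$-valued independent triangular array; that is, the $X_{n,m}$ are $A$-valued random variables on a common probability space $(\Omega,\mathcal F,\mathbb P)$, for every $n$ the variables $X_{n,1},\dots,X_{n,d_n}$ are identically distributed, and all the variables $X_{n,m}$, $n\in\mathbb N$, $1\le m\le d_n$, are jointly independent. Then there exists a sequence of measurable functions $f_n:X\to A$, $n\in\mathbb N$, such that the whole array $\{f_n\circ T^{m-1}\}_{n\in\mathbb N,\,1\le m\le d_n}$ on $(X,\mathcal B,\mu)$ has the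 same joint distribution as $\mathbb X$. -/

import Mathlib

open MeasureTheory ProbabilityTheory

namespace TriangularRealization

/-- Aperiodicity of a transformation of a measure space, in the form that makes sense on every
measure space: for `n ≥ 1`, no measurable set of positive measure has all its measurable subsets
fixed by `T⁻ⁿ` modulo null sets. When countably many measurable sets separate the points (standard
Borel spaces, Lebesgue spaces), this says that almost every point is non-periodic, see
`isAperiodic_iff_ae_forall_ne`. -/
def IsAperiodic {X : Type*} [MeasurableSpace X] (T : X → X) (μ : Measure X) : Prop :=
  ∀ n : ℕ, 1 ≤ n → ∀ E : Set X, MeasurableSet E → 0 < μ E →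
    ∃ F ⊆ E, MeasurableSet F ∧ ¬ (T^[n] ⁻¹' F =ᵐ[μ] F)

theorem isAperiodic_iff_ae_forall_ne {X : Type*} [MeasurableSpace X]
    [MeasurableSpace.CountablySeparated X] (T : X ≃ᵐ X) (μ : Measure X) :
    IsAperiodic T μ ↔ ∀ᵐ x ∂μ, ∀ n : ℕ, 1 ≤ n → T^[n] x ≠ x := by
  obtain ⟨S, hS, hsep⟩ := exists_seq_separating X MeasurableSet.empty Set.univ
  have hT : ∀ n : ℕ, Measurable (T^[n]) := fun n => T.measurable.iterate n
  constructor
  · intro h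
    rw [ae_all_iff]
    intro n
    by_cases hn : 1 ≤ n
    swap
    · exact Filter.Eventually.of_forall fun x h1 => absurd h1 hn
    have hE : {x | T^[n] x = x} = ⋂ i, {x | T^[n] x ∈ S i ↔ x ∈ S i} := by
      ext x
      simp only [Set.mem_ofPred_eq, Set.mem_iInter]
      exact ⟨fun hx i => by rw [hx], fun hx => hsep _ (Set.mem_univ _) _ (Set.mem_univ _) hx⟩
    have hEm : MeasurableSet {x | T^[n] x = x} := by
      rw [hE]
      exact MeasurableSet.iInter fun i =>
        Measurable.setOf ((((hS i).mem).comp (hT n)).iff (hS i).mem)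
    have h0 : μ {x | T^[n] x = x} = 0 := by
      by_contra hne
      obtain ⟨F, hFE, -, hF⟩ := h n hn _ hEm (pos_iff_ne_zero.2 hne)
      apply hF
      have : T^[n] ⁻¹' F = F := by
        ext x
        constructor
        · intro hx
          have h1 : T^[n] (T^[n] x) = T^[n] x := hFE hx
          have h2 : T^[n] x = x := (T.injective.iterate n) h1
          rw [Set.mem_preimage, h2] at hx
          exact hx
        · intro hx
          have h2 : T^[n] x = x := hFE hx
          rw [Set.mem_preimage, h2]
          exact hx
      exact Filter.EventuallyEq.of_eq this
    rw [ae_iff]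
    refine measure_mono_null ?_ h0
    intro x hx
    simp only [Set.mem_ofPred_eq] at hx ⊢
    by_contra hne
    exact hx fun _ => hne
  · intro h n hn E hE hpos
    by_contra hcon
    push Not at hcon
    have key : ∀ i, ∀ᵐ x ∂μ, x ∈ E → (T^[n] x ∈ S i ↔ x ∈ S i) := by
      intro i
      have h1 := hcon (E ∩ S i) Set.inter_subset_left (hE.inter (hS i))
      have h2 := hcon (E ∩ (S i)ᶜ) Set.inter_subset_left (hE.inter (hS i).compl)
      rw [Filter.eventuallyEq_set] at h1 h2
      filter_upwards [h1, h2] with x hx1 hx2 hxE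
      simp only [Set.mem_preimage, Set.mem_inter_iff, Set.mem_compl_iff] at hx1 hx2
      tauto
    have : ∀ᵐ x ∂μ, x ∉ E := by
      filter_upwards [h, ae_all_iff.2 key] with x hx hk hxE
      exact hx n hn (hsep _ (Set.mem_univ _) _ (Set.mem_univ _) fun i => hk i hxE)
    have h0 : μ E = 0 := by
      have := ae_iff.1 this
      simpa using this
    exact hpos.ne' h0

/-- An independent triangular array with rows of lengths `d n`: the entries are random variables,
the entries of each row are identically distributed, and all the entries, over all the rows, are
jointly independent. -/
structure IsTriangularArray {Ω A : Type*} [MeasurableSpace Ω] [MeasurableSpace A]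
    (P : Measure Ω) (d : ℕ → ℕ) (Y : (n : ℕ) → Fin (d n) → Ω → A) : Prop where
  measurable : ∀ n m, Measurable (Y n m)
  identDistrib : ∀ n i j, IdentDistrib (Y n i) (Y n j) P P
  indep : iIndepFun (fun (p : Σ n, Fin (d n)) => Y p.1 p.2) P

end TriangularRealization

/-! The rows are built one at a time, so everything rests on `IsAperiodic.exists_iid_row`, applied
with `Q` the finite-valued function listing all earlier rows. Aperiodicity makes `μ` divisible, so
independent letters can always be cut out of a set; the difficulty is that the same function is read
at `d` consecutive times.

Letters can be generated along an orbit from its last visit to a renewal set, each fresh relative to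
what has been seen since that visit (`IsDivisible.exists_letter`). Letters on the two sides of a
renewal may be dependent. Hence a set `S` with return times above `2 * d` is chosen, renewals happen
only in `S`, and each visit to `S` starts a block of length `d` carrying an i.i.d. word `W`,
independent of `Q` along the nearby orbit. A window of length `d` meets at most one block, and the
block keeps it from showing generated letters from both sides of a renewal. Conditionally on the
place of the block, the window therefore consists of part of `W` and of letters from a single
renewal period, with the product law and independent of `Q`. -/

namespace TriangularRealization

open scoped ENNReal

/-- Below every measurable set, the measure takes all intermediate values. -/
def IsDivisible {X : Type*} [MeasurableSpace X] (μ : Measure X) : Prop :=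
  ∀ E : Set X, MeasurableSet E → ∀ t ≤ μ E, ∃ F ⊆ E, MeasurableSet F ∧ μ F = t

/-! ### Divisibility of the measure, and independent finite-valued variables -/

section Divisible

variable {X : Type*} [MeasurableSpace X] {μ : Measure X}

/-- An aperiodic transformation has, inside every set of positive measure, a set of positive
measure which does not return to itself before a prescribed time. -/
theorem IsAperiodic.exists_subset_forall_iterate_notMem {T : X → X} [IsFiniteMeasure μ]
    (hap : IsAperiodic T μ) (hT : MeasurePreserving T μ μ) (N : ℕ) {E : Set X}
    (hE : MeasurableSet E) (hpos : 0 < μ E) :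
    ∃ S ⊆ E, MeasurableSet S ∧ 0 < μ S ∧ ∀ n, 1 ≤ n → n ≤ N → ∀ x ∈ S, T^[n] x ∉ S := by
  induction N with
  | zero => exact ⟨E, subset_rfl, hE, hpos, fun n h1 h2 => by omega⟩
  | succ N ih =>
    obtain ⟨S, hSE, hS, hSpos, hret⟩ := ih
    obtain ⟨F, hFS, hF, hne⟩ := hap (N + 1) (by omega) S hS hSpos
    have hTN := hT.iterate (N + 1)
    -- `F` and its preimage have the same finite measure, so inclusion modulo null sets would force
    -- equality.
    have hdiff : 0 < μ (F \ T^[N + 1] ⁻¹' F) := by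
      rw [pos_iff_ne_zero]
      intro h0
      apply hne
      have hle : F ≤ᵐ[μ] T^[N + 1] ⁻¹' F := ae_le_set.2 h0
      exact (ae_eq_of_ae_subset_of_measure_ge hle
        (hTN.measure_preimage hF.nullMeasurableSet).le hF.nullMeasurableSet
        (measure_ne_top _ _)).symm
    refine ⟨F \ T^[N + 1] ⁻¹' F, Set.sdiff_subset.trans (hFS.trans hSE),
      hF.diff (hTN.measurable hF), hdiff, fun n h1 h2 x hx hx' => ?_⟩
    rcases Nat.lt_or_ge N n with h | h
    · obtain rfl : n = N + 1 := by omega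
      exact hx.2 hx'.1
    · exact hret n h1 h x (hFS hx.1) (hFS hx'.1)

/-- A finite measure for which every set of positive measure has subsets of arbitrarily small
positive measure takes all intermediate values (Sierpiński). -/
theorem isDivisible_of_exists_small [IsFiniteMeasure μ]
    (h : ∀ E, MeasurableSet E → 0 < μ E → ∀ ε, 0 < ε →
      ∃ F ⊆ E, MeasurableSet F ∧ 0 < μ F ∧ μ F ≤ ε) : IsDivisible μ := by
  intro E hE t ht
  let P : Set X → Prop := fun F => MeasurableSet F ∧ F ⊆ E ∧ μ F ≤ t
  have step : ∀ F : {F // P F}, ∃ F' : {F // P F}, F.1 ⊆ F'.1 ∧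
      ∀ G ⊆ E \ F.1, MeasurableSet G → μ F.1 + μ G ≤ t → μ G / 2 ≤ μ (F'.1 \ F.1) := by
    rintro ⟨F, hF, hFE, hFt⟩
    -- Greedy exhaustion: each step adds a set of at least half the largest measure that still fits
    -- below `t`.
    let s : ℝ≥0∞ := ⨆ G : {G : Set X // G ⊆ E \ F ∧ MeasurableSet G ∧ μ F + μ G ≤ t}, μ G.1
    have hs : s ≤ μ Set.univ := iSup_le fun G => measure_mono (Set.subset_univ _)
    by_cases h0 : s = 0
    · refine ⟨⟨F, hF, hFE, hFt⟩, subset_rfl, fun G hG hGm hGt => ?_⟩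
      have : μ G ≤ s := le_iSup (fun G : {G : Set X // G ⊆ E \ F ∧ MeasurableSet G ∧
        μ F + μ G ≤ t} => μ G.1) ⟨G, hG, hGm, hGt⟩
      rw [h0, nonpos_iff_eq_zero] at this
      simp [this]
    · have hlt : s / 2 < s := ENNReal.half_lt_self h0 (hs.trans_lt (measure_lt_top _ _)).ne
      obtain ⟨⟨G₀, hG₀, hG₀m, hG₀t⟩, hG₀s⟩ := lt_iSup_iff.1 hlt
      have hdisj : Disjoint F G₀ := Set.disjoint_left.2 fun x hx hx' => (hG₀ hx').2 hx
      refine ⟨⟨F ∪ G₀, hF.union hG₀m, Set.union_subset hFE (hG₀.trans Set.sdiff_subset), ?_⟩,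
        Set.subset_union_left, fun G hG hGm hGt => ?_⟩
      · rwa [measure_union hdisj hG₀m]
      · have h1 : μ G ≤ s := le_iSup (fun G : {G : Set X // G ⊆ E \ F ∧ MeasurableSet G ∧
          μ F + μ G ≤ t} => μ G.1) ⟨G, hG, hGm, hGt⟩
        calc μ G / 2 ≤ s / 2 := ENNReal.div_le_div_right h1 2
          _ ≤ μ G₀ := hG₀s.le
          _ ≤ μ ((F ∪ G₀) \ F) := measure_mono fun x hx => ⟨Or.inr hx, (hG₀ hx).2⟩
  choose next hsub hnext using step
  let F : ℕ → {F // P F} := fun n =>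
    Nat.rec ⟨∅, MeasurableSet.empty, Set.empty_subset _, by simp⟩ (fun _ G => next G) n
  have hFs : ∀ n, F (n + 1) = next (F n) := fun n => rfl
  have hmono : Monotone fun n => (F n).1 := monotone_nat_of_le_succ fun n => hsub (F n)
  have hUm : MeasurableSet (⋃ n, (F n).1) := MeasurableSet.iUnion fun n => (F n).2.1
  have hUE : (⋃ n, (F n).1) ⊆ E := Set.iUnion_subset fun n => (F n).2.2.1
  refine ⟨⋃ n, (F n).1, hUE, hUm, ?_⟩
  have hUt : μ (⋃ n, (F n).1) ≤ t := by
    rw [hmono.measure_iUnion]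
    exact iSup_le fun n => (F n).2.2.2
  refine le_antisymm hUt (not_lt.1 fun hlt => ?_)
  have hdpos : 0 < μ (E \ ⋃ n, (F n).1) := by
    have := le_measure_sdiff (μ := μ) (s₁ := E) (s₂ := ⋃ n, (F n).1)
    exact (tsub_pos_of_lt (hlt.trans_le ht)).trans_le this
  -- If the union falls short of `t`, this one `G` was available at every step, so every step gained
  -- at least `μ G / 2`.
  obtain ⟨G, hGE, hG, hGpos, hGt⟩ := h _ (hE.diff hUm) hdpos (t - μ (⋃ n, (F n).1))
    (tsub_pos_of_lt hlt)
  have hgrow : ∀ n, μ G / 2 ≤ μ ((F (n + 1)).1 \ (F n).1) := by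
    intro n
    rw [hFs]
    refine hnext (F n) G (fun x hx => ⟨(hGE hx).1, fun hx' => (hGE hx).2
      (Set.mem_iUnion.2 ⟨n, hx'⟩)⟩) hG ?_
    calc μ (F n).1 + μ G ≤ μ (⋃ n, (F n).1) + (t - μ (⋃ n, (F n).1)) :=
          add_le_add (measure_mono (Set.subset_iUnion (fun n => (F n).1) n)) hGt
      _ = t := add_tsub_cancel_of_le hUt
  have hlin : ∀ n : ℕ, n * (μ G / 2) ≤ μ (F n).1 := by
    intro n
    induction n with
    | zero => simp
    | succ n ih =>
      rw [← Set.union_sdiff_cancel (hsub (F n)), ← hFs, measure_union disjoint_sdiff_self_right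
        ((F (n + 1)).2.1.diff (F n).2.1)]
      push_cast
      rw [add_mul, one_mul]
      exact add_le_add ih (hgrow n)
  obtain ⟨n, hn⟩ := ENNReal.exists_nat_mul_gt (a := μ G / 2) (b := t)
    (ENNReal.half_pos hGpos.ne').ne' (ht.trans_lt (measure_lt_top _ _)).ne
  exact absurd ((hlin n).trans (F n).2.2.2) (not_le.2 hn)

/-- A set without returns up to time `N` has `N` disjoint preimages of equal measure, which makes it
small. -/
theorem IsAperiodic.isDivisible {T : X → X} [IsFiniteMeasure μ]
    (hap : IsAperiodic T μ) (hT : MeasurePreserving T μ μ) : IsDivisible μ := by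
  refine isDivisible_of_exists_small fun E hE hpos ε hε => ?_
  obtain ⟨N, hN⟩ := ENNReal.exists_nat_mul_gt hε.ne' (measure_ne_top μ Set.univ)
  obtain ⟨S, hSE, hS, hSpos, hret⟩ := hap.exists_subset_forall_iterate_notMem hT N hE hpos
  refine ⟨S, hSE, hS, hSpos, ?_⟩
  by_contra! hlt
  have hdisj : Set.PairwiseDisjoint (↑(Finset.range N)) fun i => T^[i] ⁻¹' S := by
    have key : ∀ i j, i < j → j < N → ∀ x, T^[i] x ∈ S → T^[j] x ∉ S := by
      intro i j hij hj x hx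
      have := hret (j - i) (by omega) (by omega) _ hx
      rwa [← Function.iterate_add_apply, Nat.sub_add_cancel hij.le] at this
    intro i hi j hj hij
    simp only [Finset.coe_range, Set.mem_Iio] at hi hj
    refine Set.disjoint_left.2 fun x hx hx' => ?_
    rcases lt_or_gt_of_ne hij with h | h
    · exact key i j h hj x hx hx'
    · exact key j i h hi x hx' hx
  have hsum : μ (⋃ i ∈ Finset.range N, T^[i] ⁻¹' S) = N * μ S := by
    rw [measure_biUnion_finset hdisj fun i _ => (hT.iterate i).measurable hS]
    simp [(hT.iterate _).measure_preimage hS.nullMeasurableSet]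
  have : N * ε ≤ μ Set.univ :=
    calc N * ε ≤ N * μ S := by gcongr
      _ = _ := hsum.symm
      _ ≤ _ := measure_mono (Set.subset_univ _)
  exact absurd this (not_le.2 hN)

variable {A : Type*} [MeasurableSpace A]

/-- The level sets are cut out one letter at a time, each from what remains of `E`; hence the
induction has `E` varying. -/
theorem IsDivisible.exists_measurable_measure_eq [Fintype A] [Nonempty A]
    (hdiv : IsDivisible μ) [IsFiniteMeasure μ]
    {E : Set X} (hE : MeasurableSet E) (m : A → ℝ≥0∞) (hm : ∑ a, m a = μ E) :
    ∃ u : X → A, Measurable u ∧ ∀ a, μ (E ∩ u ⁻¹' {a}) = m a := by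
  classical
  suffices H : ∀ s : Finset A, ∀ E : Set X, MeasurableSet E → ∑ a ∈ s, m a = μ E →
      ∃ u : X → A, Measurable u ∧ ∀ a, μ (E ∩ u ⁻¹' {a}) = if a ∈ s then m a else 0 by
    obtain ⟨u, hu, h⟩ := H Finset.univ E hE hm
    exact ⟨u, hu, fun a => by simpa using h a⟩
  intro s
  induction s using Finset.induction_on with
  | empty =>
    intro E hE h0
    simp only [Finset.sum_empty] at h0
    exact ⟨fun _ => Classical.arbitrary A, measurable_const, fun a => by
      simpa using measure_mono_null Set.inter_subset_left h0.symm⟩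
  | insert a s ha ih =>
    intro E hE hsum
    rw [Finset.sum_insert ha] at hsum
    obtain ⟨F, hFE, hF, hFa⟩ := hdiv E hE (m a) (hsum ▸ le_self_add)
    obtain ⟨u, hu, hus⟩ := ih (E \ F) (hE.diff hF) (by
      rw [measure_sdiff hFE hF.nullMeasurableSet (measure_ne_top _ _), ← hsum, hFa]
      refine (ENNReal.add_sub_cancel_left ?_).symm
      rw [← hFa]
      exact measure_ne_top _ _)
    refine ⟨F.piecewise (fun _ => a) u, measurable_const.piecewise hF hu, fun b => ?_⟩
    have hsplit : E ∩ F.piecewise (fun _ => a) u ⁻¹' {b} =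
        (if a = b then F else ∅) ∪ ((E \ F) ∩ u ⁻¹' {b}) := by
      ext x
      have := @hFE x
      by_cases hx : x ∈ F <;> by_cases hab : a = b <;> (simp [hx, hab]; try tauto)
    have hd : Disjoint (if a = b then F else ∅) ((E \ F) ∩ u ⁻¹' {b}) := by
      split_ifs
      · exact Set.disjoint_left.2 fun x hx hx' => hx'.1.2 hx
      · simp
    have hFm : MeasurableSet (if a = b then F else ∅) := by
      split_ifs
      exacts [hF, MeasurableSet.empty]
    rw [hsplit, measure_union' hd hFm, hus b]
    by_cases hab : a = b
    · subst hab
      simp [ha, hFa]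
    · simp [hab, Finset.mem_insert, Ne.symm hab]

/-- Inside a measurable set, one finds a random variable of prescribed law which is independent of
a given finite-valued one. -/
theorem IsDivisible.exists_measurable_indep [Finite A] [DiscreteMeasurableSpace A]
    (hdiv : IsDivisible μ) [IsFiniteMeasure μ]
    {R : Set X} (hR : MeasurableSet R) (p : Measure A) [IsProbabilityMeasure p]
    {C : Type*} [Finite C] [MeasurableSpace C] [DiscreteMeasurableSpace C]
    {H : X → C} (hH : Measurable H) :
    ∃ u : X → A, Measurable u ∧ ∀ (D : Set C) (B : Set A),
      μ (R ∩ H ⁻¹' D ∩ u ⁻¹' B) = μ (R ∩ H ⁻¹' D) * p B := by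
  classical
  have := Fintype.ofFinite A
  have hpB : ∀ B : Set A, ∑ a with a ∈ B, p {a} = p B := fun B => by
    rw [sum_measure_singleton]
    simp
  have : Nonempty A := nonempty_of_isProbabilityMeasure p
  have := Fintype.ofFinite C
  have hm : ∀ c, MeasurableSet (R ∩ H ⁻¹' {c}) := fun c => hR.inter (hH (MeasurableSet.of_discrete))
  -- Each atom of `H` in `R` is split in the proportions given by `p`.
  choose u hu hua using fun c : C => hdiv.exists_measurable_measure_eq (hm c)
    (fun a => μ (R ∩ H ⁻¹' {c}) * p {a}) (by simp [← Finset.mul_sum])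
  have hum : Measurable fun x => u (H x) x :=
    measurable_from_prod_countable_right (f := fun q : C × X => u q.1 q.2) (fun c => hu c)
      |>.comp (hH.prodMk measurable_id)
  refine ⟨fun x => u (H x) x, hum, fun D B => ?_⟩
  have h1 : ∀ s : Set X, MeasurableSet s → μ (R ∩ H ⁻¹' D ∩ s) =
      ∑ c with c ∈ D, μ (R ∩ H ⁻¹' {c} ∩ s) := by
    intro s hs
    rw [← measure_biUnion_finset]
    · congr 1
      ext x
      simp only [Set.mem_inter_iff, Set.mem_preimage, Finset.mem_filter, Finset.mem_univ, true_and,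
        Set.mem_iUnion, Set.mem_singleton_iff, exists_prop]
      constructor
      · rintro ⟨⟨h1, h2⟩, h3⟩
        exact ⟨_, h2, ⟨h1, rfl⟩, h3⟩
      · rintro ⟨c, h2, ⟨h1, rfl⟩, h3⟩
        exact ⟨⟨h1, h2⟩, h3⟩
    · intro c _ c' _ hcc
      exact Set.disjoint_left.2 fun x hx hx' => hcc (hx.1.2.symm.trans hx'.1.2)
    · exact fun c _ => (hm c).inter hs
  have h2 : ∀ c, μ (R ∩ H ⁻¹' {c} ∩ (fun x => u (H x) x) ⁻¹' B) =
      μ (R ∩ H ⁻¹' {c}) * p B := by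
    intro c
    rw [← hpB, Finset.mul_sum]
    simp_rw [← hua]
    rw [← measure_biUnion_finset]
    · congr 1
      ext x
      simp only [Set.mem_inter_iff, Set.mem_preimage, Finset.mem_filter, Finset.mem_univ, true_and,
        Set.mem_iUnion, Set.mem_singleton_iff, exists_prop]
      constructor
      · rintro ⟨⟨h1, rfl⟩, h3⟩
        exact ⟨_, h3, ⟨h1, rfl⟩, rfl⟩
      · rintro ⟨a, h3, ⟨h1, rfl⟩, rfl⟩
        exact ⟨⟨h1, rfl⟩, h3⟩
    · intro a _ a' _ haa
      exact Set.disjoint_left.2 fun x hx hx' => haa (hx.2.symm.trans hx'.2)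
    · exact fun a _ => (hm c).inter (hu c (MeasurableSet.of_discrete))
  rw [h1 _ (hum MeasurableSet.of_discrete)]
  simp_rw [h2]
  rw [← Finset.sum_mul]
  congr 1
  simpa using (h1 Set.univ MeasurableSet.univ).symm

end Divisible

/-! ### Letters generated from the last visit to a renewal set -/

section Letters

/-- Recursive choice of a sequence, each term being chosen in terms of the previous ones. -/
theorem exists_seq_of_forall_exists {F : Type*} (P : (n : ℕ) → (Fin n → F) → F → Prop)
    (h : ∀ n u, ∃ v, P n u v) : ∃ u : ℕ → F, ∀ n, P n (fun i => u i) (u n) := by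
  choose g hg using h
  let u : ℕ → F := fun n => WellFounded.fix Nat.lt_wfRel.wf
    (fun n ih => g n (fun i => ih i i.2)) n
  have hu : ∀ n, u n = g n (fun i => u i) := fun n => WellFounded.fix_eq _ _ _
  exact ⟨u, fun n => by rw [hu n]; exact hg n _⟩

variable {X : Type*} [MeasurableSpace X] {μ : Measure X} [IsProbabilityMeasure μ]
  {A : Type*} [Finite A] [MeasurableSpace A] [DiscreteMeasurableSpace A]
  {Γ : Type*} [Finite Γ] [MeasurableSpace Γ] [DiscreteMeasurableSpace Γ]

/-- On a set `R`, there is a sequence of random variables of law `p` such that the `n`-th one is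
independent of the previous ones and of the `γ`-names of length `n`. -/
theorem IsDivisible.exists_adapted_seq (hdiv : IsDivisible μ) {T : X → X} (hT : Measurable T)
    {R : Set X} (hR : MeasurableSet R) {γ : X → Γ} (hγ : Measurable γ)
    (p : Measure A) [IsProbabilityMeasure p] :
    ∃ u : ℕ → X → A, (∀ n, Measurable (u n)) ∧ ∀ n (E : Set X),
      (∀ y y', (∀ i ≤ n, γ (T^[i] y) = γ (T^[i] y')) → (∀ i < n, u i y = u i y') →
        y ∈ E → y' ∈ E) →
      ∀ B : Set A, μ (R ∩ E ∩ u n ⁻¹' B) = μ (R ∩ E) * p B := by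
  obtain ⟨u, hu⟩ := exists_seq_of_forall_exists (F := {f : X → A // Measurable f})
    (fun n u v => ∀ E : Set X, (∀ y y', (∀ i ≤ n, γ (T^[i] y) = γ (T^[i] y')) →
      (∀ i, (u i).1 y = (u i).1 y') → y ∈ E → y' ∈ E) →
      ∀ B : Set A, μ (R ∩ E ∩ v.1 ⁻¹' B) = μ (R ∩ E) * p B) (by
    intro n u
    -- Everything an admissible `E` may depend on: names up to time `n` inclusive, letters strictly
    -- before.
    let H : X → (Fin (n + 1) → Γ) × (Fin n → A) :=
      fun y => (fun i => γ (T^[i] y), fun i => (u i).1 y)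
    have hH : Measurable H := by
      refine Measurable.prodMk (measurable_pi_lambda _ fun i => ?_)
        (measurable_pi_lambda _ fun i => (u i).2)
      exact hγ.comp (hT.iterate i)
    obtain ⟨v, hv, hind⟩ := hdiv.exists_measurable_indep hR p hH
    refine ⟨⟨v, hv⟩, fun E hE B => ?_⟩
    have hEH : H ⁻¹' (Set.image H E) = E := by
      refine Set.Subset.antisymm ?_ (Set.subset_preimage_image _ _)
      rintro y' ⟨y, hy, hyy⟩
      refine hE y y' (fun i hi => ?_) (fun i => ?_) hy
      · exact congrFun (congrArg Prod.fst hyy) ⟨i, Nat.lt_succ_of_le hi⟩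
      · exact congrFun (congrArg Prod.snd hyy) i
    simpa [hEH] using hind (Set.image H E) B)
  exact ⟨fun n => (u n).1, fun n => (u n).2, fun n E hE =>
    hu n E fun y y' h1 h2 => hE y y' h1 fun i hi => h2 ⟨i, hi⟩⟩

theorem iterate_symm_iterate (T : X ≃ᵐ X) (n : ℕ) (x : X) : T^[n] (T.symm^[n] x) = x :=
  Function.LeftInverse.iterate T.apply_symm_apply n x

theorem symm_iterate_iterate (T : X ≃ᵐ X) (n : ℕ) (x : X) : T.symm^[n] (T^[n] x) = x :=
  Function.LeftInverse.iterate T.symm_apply_apply n x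

theorem iterate_symm_iterate_of_le (T : X ≃ᵐ X) {m n : ℕ} (h : m ≤ n) (x : X) :
    T^[m] (T.symm^[n] x) = T.symm^[n - m] x := by
  obtain ⟨k, rfl⟩ := Nat.exists_eq_add_of_le h
  rw [Function.iterate_add_apply, iterate_symm_iterate, Nat.add_sub_cancel_left]

/-- Almost every orbit has visited a given set of positive measure in the past. -/
theorem ae_exists_symm_iterate_mem {T : X ≃ᵐ X} (hT : Ergodic T μ) {R : Set X}
    (hR : MeasurableSet R) (hpos : 0 < μ R) : ∀ᵐ x ∂μ, ∃ n : ℕ, T.symm^[n] x ∈ R := by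
  have hV : MeasurableSet {x | ∃ n : ℕ, T.symm^[n] x ∈ R} := by
    simp only [Set.ofPred_exists]
    exact MeasurableSet.iUnion fun n => T.symm.measurable.iterate n hR
  have hsub : {x | ∃ n : ℕ, T.symm^[n] x ∈ R} ⊆ T ⁻¹' {x | ∃ n : ℕ, T.symm^[n] x ∈ R} := by
    rintro x ⟨n, hn⟩
    exact ⟨n + 1, by simpa using hn⟩
  rcases hT.ae_empty_or_univ_of_ae_le_preimage hV.nullMeasurableSet
    (Filter.Eventually.of_forall hsub) with h | h
  · have h0 : μ R ≤ 0 := by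
      rw [← measure_empty (μ := μ), ← measure_congr h]
      exact measure_mono fun x hx => ⟨0, hx⟩
    exact absurd hpos (not_lt.2 h0)
  · exact Filter.eventuallyEq_univ.1 h

/-- There is a random letter with the following property: the letters read along an orbit before
the first return to the set `γ ⁻¹' K` are independent, also of the value of `γ`. -/
theorem IsDivisible.exists_letter (hdiv : IsDivisible μ) {T : X ≃ᵐ X} (hT : Ergodic T μ)
    {γ : X → Γ} (hγ : Measurable γ) {K : Set Γ} (hpos : 0 < μ (γ ⁻¹' K))
    (p : Measure A) [IsProbabilityMeasure p] :
    ∃ u : X → A, Measurable u ∧ ∀ (D : Set Γ) (J : Finset ℕ),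
      (∀ x, γ x ∈ D → ∀ i j, 1 ≤ i → i ≤ j → j ∈ J → γ (T^[i] x) ∉ K) → ∀ B : ℕ → Set A,
      μ (γ ⁻¹' D ∩ {x | ∀ i ∈ J, u (T^[i] x) ∈ B i}) = μ (γ ⁻¹' D) * ∏ i ∈ J, p (B i) := by
  have hK : MeasurableSet (γ ⁻¹' K) := hγ MeasurableSet.of_discrete
  obtain ⟨v, hv, hind⟩ := hdiv.exists_adapted_seq T.measurable hK hγ p
  have hTm : ∀ n, Measurable (T^[n]) := fun n => T.measurable.iterate n
  have hTsm : ∀ n, Measurable (T.symm^[n]) := fun n => T.symm.measurable.iterate n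
  let E : ℕ → Set X := fun j => {y | ∀ i, 1 ≤ i → i ≤ j → γ (T^[i] y) ∉ K}
  -- The points whose last visit to `γ ⁻¹' K` was `j` steps ago; there `u` will be `v j` read at
  -- that visit.
  let t : ℕ → Set X := fun j => T.symm^[j] ⁻¹' (γ ⁻¹' K ∩ E j)
  have hE : ∀ j, MeasurableSet (E j) := fun j => by
    simp only [E, Set.ofPred_forall]
    exact MeasurableSet.iInter fun i => MeasurableSet.iInter fun _ => MeasurableSet.iInter fun _ =>
      (hγ.comp (hTm i)) (MeasurableSet.of_discrete (s := Kᶜ))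
  have ht : ∀ j, MeasurableSet (t j) := fun j => hTsm j (hK.inter (hE j))
  have hdisj_aux : ∀ j k, j < k → ∀ x, x ∈ t j → x ∉ t k := by
    intro j k hjk x hj hk
    refine hk.2 (k - j) (by omega) (by omega) ?_
    rw [iterate_symm_iterate_of_le T (Nat.sub_le k j), Nat.sub_sub_self hjk.le]
    exact hj.1
  have hdisj : Pairwise (Function.onFun Disjoint t) := by
    intro j k hjk
    refine Set.disjoint_left.2 fun x hj hk => ?_
    rcases lt_or_gt_of_ne hjk with h | h
    · exact hdisj_aux j k h x hj hk
    · exact hdisj_aux k j h x hk hj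
  obtain ⟨u, hu, huv⟩ := exists_measurable_piecewise t ht (fun j x => v j (T.symm^[j] x))
    (fun j => (hv j).comp (hTsm j)) (fun j k hjk x hx =>
      absurd hx.2 (Set.disjoint_left.1 (hdisj hjk) hx.1))
  have huv' : ∀ j y, γ y ∈ K → y ∈ E j → u (T^[j] y) = v j y := by
    intro j y h1 h2
    have := huv j (x := T^[j] y) (by simpa [t, symm_iterate_iterate] using ⟨h1, h2⟩)
    simpa [symm_iterate_iterate] using this
  have hcover : ∀ᵐ x ∂μ, x ∈ ⋃ j, t j := by
    filter_upwards [ae_exists_symm_iterate_mem hT hK hpos] with x hx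
    classical
    refine Set.mem_iUnion.2 ⟨Nat.find hx, Nat.find_spec hx, fun i hi hi' hmem => ?_⟩
    rw [iterate_symm_iterate_of_le T hi'] at hmem
    exact Nat.find_min hx (by omega) hmem
  have hdecomp : ∀ M, MeasurableSet M → μ M = ∑' j, μ (γ ⁻¹' K ∩ E j ∩ T^[j] ⁻¹' M) := by
    intro M hM
    have h1 : μ M = μ (⋃ j, t j ∩ M) := by
      rw [← Set.iUnion_inter]
      refine measure_congr ?_
      filter_upwards [hcover] with x hx
      exact propext ⟨fun h => ⟨hx, h⟩, fun h => h.2⟩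
    rw [h1, measure_iUnion (fun j k hjk => (hdisj hjk).mono Set.inter_subset_left
      Set.inter_subset_left) fun j => (ht j).inter hM]
    refine tsum_congr fun j => ?_
    rw [← (hT.toMeasurePreserving.iterate j).measure_preimage ((ht j).inter hM).nullMeasurableSet]
    congr 1
    ext y
    simp [t, symm_iterate_iterate]
  refine ⟨u, hu, fun D J hJ B => ?_⟩
  have hDm : MeasurableSet (γ ⁻¹' D) := hγ MeasurableSet.of_discrete
  have hJm : MeasurableSet {x | ∀ i ∈ J, u (T^[i] x) ∈ B i} := by
    simp only [Set.ofPred_forall]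
    exact MeasurableSet.iInter fun i => MeasurableSet.iInter fun _ =>
      (hu.comp (hTm i)) MeasurableSet.of_discrete
  rw [hdecomp _ hDm, hdecomp _ (hDm.inter hJm), ← ENNReal.tsum_mul_right]
  refine tsum_congr fun j => ?_
  -- Peel off the largest index: the rest of the event depends only on names up to time `j` and on
  -- earlier letters.
  have key : ∀ L : Finset ℕ,
      μ (γ ⁻¹' K ∩ (E j ∩ T^[j] ⁻¹' (γ ⁻¹' D) ∩ {y | ∀ i ∈ L, v (j + i) y ∈ B i})) =
      μ (γ ⁻¹' K ∩ E j ∩ T^[j] ⁻¹' (γ ⁻¹' D)) * ∏ i ∈ L, p (B i) := by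
    intro L
    induction L using Finset.induction_on_max with
    | empty => simp [Set.inter_assoc]
    | insert n L hn ih =>
      rw [Finset.prod_insert fun h => lt_irrefl _ (hn n h), mul_left_comm, ← ih, mul_comm,
        ← hind (j + n)]
      · congr 1
        ext y
        simp only [Set.mem_inter_iff, Set.mem_preimage, Set.mem_ofPred_eq, Finset.mem_insert,
          forall_eq_or_imp]
        tauto
      · rintro y y' h1 h2 ⟨⟨h3, h4⟩, h5⟩
        refine ⟨⟨fun i hi hi' => ?_, ?_⟩, fun i hi => ?_⟩
        · rw [← h1 i (by omega)]
          exact h3 i hi hi'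
        · rw [Set.mem_preimage, Set.mem_preimage, ← h1 j (by omega)]
          exact h4
        · rw [← h2 (j + i) (by have := hn i hi; omega)]
          exact h5 i hi
  rw [← key J]
  congr 1
  ext y
  simp only [Set.mem_inter_iff, Set.mem_preimage, Set.mem_ofPred_eq]
  have hiff : γ y ∈ K → y ∈ E j → γ (T^[j] y) ∈ D →
      ((∀ i ∈ J, u (T^[i] (T^[j] y)) ∈ B i) ↔ ∀ i ∈ J, v (j + i) y ∈ B i) := by
    intro h1 h2 h3
    refine forall₂_congr fun i hi => ?_
    rw [← Function.iterate_add_apply, add_comm i j, huv' (j + i) y h1]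
    intro k hk hk'
    -- Up to time `j` a return is excluded by `E j`, later by the hypothesis on `J`.
    rcases le_or_gt k j with h | h
    · exact h2 k hk h
    · have := hJ _ h3 (k - j) i (by omega) (by omega) hi
      rwa [← Function.iterate_add_apply, Nat.sub_add_cancel h.le] at this
  tauto

end Letters

/-! ### One row, independent of a given finite-valued variable -/

section Row

theorem exists_singleton_measure_pos {A : Type*} [Finite A] [MeasurableSpace A]
    (p : Measure A) [IsProbabilityMeasure p] :
    ∃ a, 0 < p {a} := by
  by_contra! h
  have h0 : p Set.univ = 0 := by
    rw [← Set.biUnion_of_singleton Set.univ]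
    exact (measure_biUnion_null_iff Set.countable_univ).2 fun a _ => nonpos_iff_eq_zero.1 (h a)
  simp at h0

variable {X : Type*} [MeasurableSpace X] {μ : Measure X} [IsProbabilityMeasure μ]
  {A : Type*} [Finite A] [MeasurableSpace A] [DiscreteMeasurableSpace A]
  {C : Type*} [Finite C] [MeasurableSpace C] [DiscreteMeasurableSpace C]

/-- The part of the window `[0, d)` lying in the block of length `d` which starts at `j - d`,
read in the coordinates of the window and in those of the block. -/
theorem prod_window_mul_prod_block {M : Type*} [CommMonoid M] (d j : ℕ) (q : ℕ → M) :
    (∏ i ∈ Finset.range d with ¬ (j ≤ d + i ∧ d + i < j + d), q i) *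
      ∏ k : Fin d, (if d ≤ j + k ∧ j + k < 2 * d then q (j + k - d) else 1) =
    ∏ i ∈ Finset.range d, q i := by
  rw [Fin.prod_univ_eq_prod_range
    (fun k => if d ≤ j + k ∧ j + k < 2 * d then q (j + k - d) else 1) d, ← Finset.prod_filter,
    mul_comm, ← Finset.prod_filter_mul_prod_filter_not (Finset.range d)
      (fun i => j ≤ d + i ∧ d + i < j + d) q]
  congr 1
  refine Finset.prod_nbij' (fun k => j + k - d) (fun i => d + i - j) ?_ ?_ ?_ ?_ ?_ <;>
    intro i hi <;> simp only [Finset.mem_filter, Finset.mem_range] at hi ⊢ <;> omega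

/-- Every finite-valued random variable admits an independent row of i.i.d. variables of prescribed
law which is of the form `f, f ∘ T, …, f ∘ T^(d-1)`. -/
theorem IsAperiodic.exists_iid_row {T : X ≃ᵐ X} (hap : IsAperiodic T μ) (hT : Ergodic T μ)
    {Q : X → C} (hQ : Measurable Q) (p : Measure A) [IsProbabilityMeasure p] (d : ℕ) :
    ∃ f : X → A, Measurable f ∧ ∀ (D : Set C) (B : ℕ → Set A),
      μ (Q ⁻¹' D ∩ {x | ∀ i < d, f (T^[i] x) ∈ B i}) =
        μ (Q ⁻¹' D) * ∏ i ∈ Finset.range d, p (B i) := by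
  have hdiv := hap.isDivisible hT.toMeasurePreserving
  have hTm : ∀ n, Measurable (T^[n]) := fun n => T.measurable.iterate n
  have hTsm : ∀ n, Measurable (T.symm^[n]) := fun n => T.symm.measurable.iterate n
  -- the blocks, and the words written on them
  obtain ⟨S, -, hS, hSpos, hret⟩ := hap.exists_subset_forall_iterate_notMem
    hT.toMeasurePreserving (2 * d) MeasurableSet.univ (by simp)
  have hsep : ∀ m n y, m < 2 * d → n < 2 * d → T^[m] y ∈ S → T^[n] y ∈ S → m = n := by
    have aux : ∀ m n y, m < n → n < 2 * d → T^[m] y ∈ S → T^[n] y ∉ S := by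
      intro m n y hmn hn hm
      have := hret (n - m) (by omega) (by omega) _ hm
      rwa [← Function.iterate_add_apply, Nat.sub_add_cancel hmn.le] at this
    intro m n y hm hn h1 h2
    rcases lt_trichotomy m n with h | h | h
    · exact absurd h2 (aux m n y h hn h1)
    · exact h
    · exact absurd h1 (aux n m y h hm h2)
  -- `Q` at times `-d, …, d` around the start of a block, which covers the origin of every window
  -- that the block meets.
  let N : X → Fin (2 * d + 1) → C := fun s i => Q (T^[i] (T.symm^[d] s))
  have hN : Measurable N := measurable_pi_lambda _ fun i => hQ.comp ((hTm i).comp (hTsm d))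
  obtain ⟨W, hW, hWind⟩ := hdiv.exists_measurable_indep hS (Measure.pi fun _ : Fin d => p) hN
  -- the letters outside of the blocks
  obtain ⟨a, ha⟩ := exists_singleton_measure_pos p
  let γ : X → C × (Fin (2 * d + 1) → Prop × (Fin d → A)) := fun x =>
    (Q x, fun j => (T^[j] (T.symm^[d] x) ∈ S, W (T^[j] (T.symm^[d] x))))
  have hγ : Measurable γ := by
    refine hQ.prodMk (measurable_pi_lambda _ fun j => ?_)
    exact Measurable.prodMk (hS.mem.comp ((hTm j).comp (hTsm d)))
      (hW.comp ((hTm j).comp (hTsm d)))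
  -- Of this renewal set, only positive measure and the inclusion of `γ ⁻¹' K` in `S` matter below.
  let K : Set (C × (Fin (2 * d + 1) → Prop × (Fin d → A))) :=
    {c | (c.2 ⟨d, by omega⟩).1 ∧ (c.2 ⟨d, by omega⟩).2 = fun _ => a}
  have hK : γ ⁻¹' K = S ∩ W ⁻¹' {fun _ => a} := by
    ext x
    simp [K, γ, iterate_symm_iterate]
  have hKS : ∀ x i, γ (T^[i] x) ∈ K → T^[d + i] (T.symm^[d] x) ∈ S := by
    intro x i hx
    rw [← Set.mem_preimage, hK] at hx
    rw [add_comm, Function.iterate_add_apply, iterate_symm_iterate]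
    exact hx.1
  have hKpos : 0 < μ (γ ⁻¹' K) := by
    have := hWind Set.univ {fun _ => a}
    rw [Set.preimage_univ, Set.inter_univ] at this
    rw [hK, this, Measure.pi_singleton]
    exact ENNReal.mul_pos hSpos.ne' (Finset.prod_ne_zero_iff.2 fun _ _ => ha.ne')
  obtain ⟨u, hu, huind⟩ := hdiv.exists_letter hT hγ hKpos p
  -- the function
  let t : Option (Fin d) → Set X := fun o => o.elim
    (⋂ i : Fin d, (T.symm^[i] ⁻¹' S)ᶜ) fun i => T.symm^[i] ⁻¹' S
  obtain ⟨f, hf, hft⟩ := exists_measurable_piecewise t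
    (by
      rintro (_ | i)
      · exact MeasurableSet.iInter fun i => (hTsm i hS).compl
      · exact hTsm i hS)
    (fun o => o.elim u fun i x => W (T.symm^[i] x) i)
    (by
      rintro (_ | i)
      · exact hu
      · exact (measurable_pi_apply i).comp (hW.comp (hTsm i)))
    (by
      have hdj : ∀ i j : Fin d, i ≠ j → ∀ x, T.symm^[i] x ∈ S → T.symm^[j] x ∉ S := by
        intro i j hij x hi hj
        have hi' := i.2
        have hj' := j.2
        have := hsep (d - i) (d - j) (T.symm^[d] x) (by omega) (by omega)
          (by rwa [iterate_symm_iterate_of_le T (Nat.sub_le _ _), Nat.sub_sub_self hi'.le])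
          (by rwa [iterate_symm_iterate_of_le T (Nat.sub_le _ _), Nat.sub_sub_self hj'.le])
        exact hij (Fin.ext (by omega))
      rintro (_ | i) (_ | j) hij x ⟨h1, h2⟩
      · exact absurd rfl hij
      · exact absurd h2 (Set.mem_iInter.1 h1 j)
      · exact absurd h1 (Set.mem_iInter.1 h2 i)
      · exact absurd h2 (hdj i j (fun h => hij (by rw [h])) x h1))
  have hfu : ∀ x, (∀ i < d, T.symm^[i] x ∉ S) → f x = u x := fun x hx =>
    hft none (Set.mem_iInter.2 fun i => hx i i.2)
  have hfW : ∀ s ∈ S, ∀ i : Fin d, f (T^[i] s) = W s i := by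
    intro s hs i
    have := hft (some i) (x := T^[i] s) (by
      change T.symm^[i] (T^[i] s) ∈ S
      rwa [symm_iterate_iterate])
    simpa [symm_iterate_iterate] using this
  have hback : ∀ x i k, k < d → T.symm^[k] (T^[i] x) = T^[d + i - k] (T.symm^[d] x) := by
    intro x i k hk
    have : T^[i] x = T^[k] (T^[d + i - k] (T.symm^[d] x)) := by
      rw [← Function.iterate_add_apply, Nat.add_sub_cancel' (by omega), add_comm,
        Function.iterate_add_apply, iterate_symm_iterate]
    rw [this, symm_iterate_iterate]
  refine ⟨f, hf, fun D B => ?_⟩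
  have hQD : MeasurableSet (Q ⁻¹' D) := hQ MeasurableSet.of_discrete
  have hM : MeasurableSet (Q ⁻¹' D ∩ {x | ∀ i < d, f (T^[i] x) ∈ B i}) := by
    refine hQD.inter ?_
    simp only [Set.ofPred_forall]
    exact MeasurableSet.iInter fun i => MeasurableSet.iInter fun _ =>
      (hf.comp (hTm i)) MeasurableSet.of_discrete
  -- decomposition according to the place of the block which meets the window
  let V : ℕ → Set X := fun j => {x | T^[j] (T.symm^[d] x) ∈ S}
  have hV : ∀ j, MeasurableSet (V j) := fun j => ((hTm j).comp (hTsm d)) hS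
  have hdec : ∀ M, MeasurableSet M → μ M =
      ∑ j ∈ Finset.Ico 1 (2 * d), μ (M ∩ V j) + μ (M \ ⋃ j ∈ Finset.Ico 1 (2 * d), V j) := by
    intro M hM
    rw [← measure_inter_add_sdiff M
      (Finset.measurableSet_biUnion (Finset.Ico 1 (2 * d)) fun j _ => hV j), Set.inter_iUnion₂,
      measure_biUnion_finset]
    · intro j hj k hk hjk
      simp only [Finset.coe_Ico, Set.mem_Ico] at hj hk
      exact Set.disjoint_left.2 fun x hx hx' => hjk (hsep _ _ _ hj.2 hk.2 hx.2 hx'.2)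
    · exact fun j _ => hM.inter (hV j)
  rw [hdec _ hM, hdec _ hQD, add_mul, Finset.sum_mul]
  congr 1
  · refine Finset.sum_congr rfl fun j hj => ?_
    rw [Finset.mem_Ico] at hj
    let B' : Fin d → Set A := fun k =>
      if d ≤ j + k ∧ j + k < 2 * d then B (j + k - d) else Set.univ
    let D' : Set (C × (Fin (2 * d + 1) → Prop × (Fin d → A))) :=
      {c | c.1 ∈ D ∧ (c.2 ⟨j, by omega⟩).1 ∧ ∀ k, (c.2 ⟨j, by omega⟩).2 k ∈ B' k}
    let J : Finset ℕ := {i ∈ Finset.range d | ¬ (j ≤ d + i ∧ d + i < j + d)}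
    -- By invariance, move to the start of the block, where `W` is independent of `N` and `Q x` is
    -- the coordinate `2 * d - j` of `N`.
    have hshift : ∀ B₀ : Fin d → Set A,
        μ (Q ⁻¹' D ∩ V j ∩ {x | ∀ k, W (T^[j] (T.symm^[d] x)) k ∈ B₀ k}) =
        μ (S ∩ N ⁻¹' {n | n ⟨2 * d - j, by omega⟩ ∈ D}) * ∏ k, p (B₀ k) := by
      intro B₀
      rw [← Measure.pi_pi, ← hWind, ← ((hT.toMeasurePreserving.iterate j).comp
        ((hT.toMeasurePreserving.symm T).iterate d)).measure_preimage
        ((hS.inter (hN MeasurableSet.of_discrete)).inter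
          (hW MeasurableSet.of_discrete)).nullMeasurableSet]
      congr 1
      ext x
      have hx : T^[2 * d - j] (T.symm^[d] (T^[j] (T.symm^[d] x))) = x := by
        have hcomm : Function.Commute T.symm T := fun y => by simp
        rw [hcomm.iterate_iterate, ← Function.iterate_add_apply, ← Function.iterate_add_apply,
          Nat.sub_add_cancel hj.2.le, ← two_mul, iterate_symm_iterate]
      simp only [V, N, Set.mem_inter_iff, Set.mem_preimage, Set.mem_ofPred_eq,
        Function.comp_apply, hx, Set.mem_pi, Set.mem_univ, forall_true_left]
      tauto
    have hVj : μ (Q ⁻¹' D ∩ V j) = μ (S ∩ N ⁻¹' {n | n ⟨2 * d - j, by omega⟩ ∈ D}) := by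
      simpa using hshift fun _ => Set.univ
    have hγD : γ ⁻¹' D' = Q ⁻¹' D ∩ V j ∩ {x | ∀ k, W (T^[j] (T.symm^[d] x)) k ∈ B' k} := by
      ext x
      simp only [D', γ, V, Set.mem_inter_iff, Set.mem_preimage, Set.mem_ofPred_eq, and_assoc]
    have hev : Q ⁻¹' D ∩ {x | ∀ i < d, f (T^[i] x) ∈ B i} ∩ V j =
        γ ⁻¹' D' ∩ {x | ∀ i ∈ J, u (T^[i] x) ∈ B i} := by
      rw [hγD]
      ext x
      have hcase : x ∈ V j → ((∀ i < d, f (T^[i] x) ∈ B i) ↔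
          (∀ k, W (T^[j] (T.symm^[d] x)) k ∈ B' k) ∧ ∀ i ∈ J, u (T^[i] x) ∈ B i) := by
        intro hx
        have hin : ∀ k : Fin d, d ≤ j + k →
            f (T^[j + k - d] x) = W (T^[j] (T.symm^[d] x)) k := by
          intro k hk
          rw [← hfW _ hx k, ← Function.iterate_add_apply, add_comm (k : ℕ) j,
            ← Nat.sub_add_cancel hk, Function.iterate_add_apply _ _ d, iterate_symm_iterate,
            Nat.sub_add_cancel hk]
        have hout : ∀ i ∈ J, f (T^[i] x) = u (T^[i] x) := by
          intro i hi
          simp only [J, Finset.mem_filter, Finset.mem_range] at hi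
          refine hfu _ fun k hk hmem => ?_
          rw [hback x i k hk] at hmem
          have := hsep _ _ _ (by omega) hj.2 hmem hx
          omega
        constructor
        · refine fun h => ⟨fun k => ?_, fun i hi => ?_⟩
          · by_cases hk : d ≤ j + k ∧ j + k < 2 * d
            · simp only [B', hk, and_self, if_true]
              rw [← hin k hk.1]
              exact h _ (by omega)
            · simp [B', hk]
          · rw [← hout i hi]
            exact h i (by simp [J] at hi; exact hi.1)
        · rintro ⟨h1, h2⟩ i hi
          by_cases hiJ : i ∈ J
          · rw [hout i hiJ]
            exact h2 i hiJ
          · have hij : j ≤ d + i ∧ d + i < j + d := by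
              by_contra hc
              exact hiJ (by simp only [J, Finset.mem_filter, Finset.mem_range]; exact ⟨hi, hc⟩)
            have h3 := h1 ⟨d + i - j, by omega⟩
            have h4 := hin ⟨d + i - j, by omega⟩ (by simp only; omega)
            have h5 : j + (d + i - j) - d = i := by omega
            have h6 : d ≤ j + (d + i - j) ∧ j + (d + i - j) < 2 * d := by omega
            simp only [B', h5, h6, and_self, if_true] at h3 h4
            rw [h4]
            exact h3
      simp only [Set.mem_inter_iff, Set.mem_ofPred_eq]
      tauto
    rw [hev, huind D' J, hγD, hshift, hVj, mul_assoc,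
      ← prod_window_mul_prod_block d j fun i => p (B i), mul_comm (∏ k, p (B' k))]
    · congr 2
      refine Finset.prod_congr rfl fun k _ => ?_
      simp only [B']
      split_ifs <;> simp
    -- A renewal at time `i` would be the start of the block, which then covers the rest of the
    -- window, including `i'`.
    · intro x hx i i' hi hii hi' hK'
      have h1 := hKS x i hK'
      simp only [J, Finset.mem_filter, Finset.mem_range] at hi'
      have := hsep _ _ _ (by omega) hj.2 h1 hx.2.1
      omega
  -- No block meets the window: all its letters are generated ones, without a renewal in between.
  · let D' : Set (C × (Fin (2 * d + 1) → Prop × (Fin d → A))) :=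
      {c | c.1 ∈ D ∧ ∀ j : Fin (2 * d + 1), 1 ≤ (j : ℕ) → (j : ℕ) < 2 * d → ¬ (c.2 j).1}
    have hγD : γ ⁻¹' D' = Q ⁻¹' D \ ⋃ j ∈ Finset.Ico 1 (2 * d), V j := by
      ext x
      simp only [D', γ, V, Set.mem_preimage, Set.mem_ofPred_eq, Set.mem_sdiff, Set.mem_iUnion,
        Finset.mem_Ico, not_exists]
      exact and_congr_right fun _ => ⟨fun h j hj => h ⟨j, by omega⟩ hj.1 hj.2,
        fun h j h1 h2 => h j ⟨h1, h2⟩⟩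
    have hev : (Q ⁻¹' D ∩ {x | ∀ i < d, f (T^[i] x) ∈ B i}) \ ⋃ j ∈ Finset.Ico 1 (2 * d), V j =
        γ ⁻¹' D' ∩ {x | ∀ i ∈ Finset.range d, u (T^[i] x) ∈ B i} := by
      rw [hγD]
      ext x
      have hcase : x ∉ ⋃ j ∈ Finset.Ico 1 (2 * d), V j → ((∀ i < d, f (T^[i] x) ∈ B i) ↔
          ∀ i < d, u (T^[i] x) ∈ B i) := by
        intro hx
        refine forall₂_congr fun i hi => ?_
        rw [hfu _ fun k hk hmem => hx ?_]
        rw [hback x i k hk] at hmem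
        exact Set.mem_iUnion₂.2 ⟨d + i - k, Finset.mem_Ico.2 (by omega), hmem⟩
      simp only [Set.mem_inter_iff, Set.mem_sdiff, Set.mem_ofPred_eq, Finset.mem_range]
      tauto
    rw [hev, huind D' (Finset.range d), hγD]
    intro x hx i i' hi hii hi' hK'
    rw [Finset.mem_range] at hi'
    exact hx.2 ⟨d + i, by omega⟩ (by simp only; omega) (by simp only; omega) (hKS x i hK')

end Row

/-! ### From single rows to the law of the whole array -/

section Array

/-- An array of iterates whose finite parts have product laws has an infinite product law. -/
theorem map_array_eq_infinitePi {X : Type*} [MeasurableSpace X] {μ : Measure X}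
    {A : Type*} [MeasurableSpace A] {T : X ≃ᵐ X}
    (p : ℕ → Measure A) [∀ n, IsProbabilityMeasure (p n)] (d : ℕ → ℕ) {f : ℕ → X → A}
    (hf : ∀ n, Measurable (f n))
    (h : ∀ (N : ℕ) (B : ℕ → ℕ → Set A),
      μ {x | ∀ n < N, ∀ i < d n, f n (T^[i] x) ∈ B n i} =
        ∏ n ∈ Finset.range N, ∏ i ∈ Finset.range (d n), p n (B n i)) :
    μ.map (fun x (q : Σ n, Fin (d n)) => f q.1 (T^[q.2] x)) =
      Measure.infinitePi fun q : Σ n, Fin (d n) => p q.1 := by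
  classical
  refine Measure.eq_infinitePi _ fun s t ht => ?_
  have hm : Measurable fun x (q : Σ n, Fin (d n)) => f q.1 (T^[q.2] x) :=
    measurable_pi_lambda _ fun q => (hf q.1).comp (T.measurable.iterate q.2)
  rw [Measure.map_apply hm
    (MeasurableSet.pi s.countable_toSet fun q _ => ht q)]
  obtain ⟨N, hN⟩ : ∃ N, ∀ q ∈ s, q.1 < N :=
    ⟨s.sup Sigma.fst + 1, fun q hq => Nat.lt_succ_of_le (Finset.le_sup (f := Sigma.fst) hq)⟩
  -- Fill the finite cylinder up to complete rows with the trivial condition.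
  let B : ℕ → ℕ → Set A := fun n i =>
    if hi : i < d n then (if (⟨n, ⟨i, hi⟩⟩ : Σ n, Fin (d n)) ∈ s then t ⟨n, ⟨i, hi⟩⟩ else Set.univ)
    else Set.univ
  have hset : (fun x (q : Σ n, Fin (d n)) => f q.1 (T^[q.2] x)) ⁻¹' Set.pi s t =
      {x | ∀ n < N, ∀ i < d n, f n (T^[i] x) ∈ B n i} := by
    ext x
    constructor
    · intro hx n _ i hi
      by_cases hs : (⟨n, ⟨i, hi⟩⟩ : Σ n, Fin (d n)) ∈ s
      · simpa [B, hi, hs] using hx _ hs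
      · simp [B, hi, hs]
    · rintro hx ⟨n, i⟩ hs
      have := hx n (hN _ hs) i i.2
      simpa [B, Finset.mem_coe.1 hs] using this
  rw [hset, h]
  have hB : ∀ n, ∏ i ∈ Finset.range (d n), p n (B n i) =
      ∏ i : Fin (d n), if (⟨n, i⟩ : Σ n, Fin (d n)) ∈ s then p n (t ⟨n, i⟩) else 1 := by
    intro n
    rw [← Fin.prod_univ_eq_prod_range (fun i => p n (B n i))]
    refine Finset.prod_congr rfl fun i _ => ?_
    simp only [B, i.2, dif_pos, Fin.eta]
    split_ifs <;> simp
  simp_rw [hB]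
  rw [Finset.prod_sigma' (Finset.range N) (fun n => (Finset.univ : Finset (Fin (d n))))
    (fun n i => if (⟨n, i⟩ : Σ n, Fin (d n)) ∈ s then p n (t ⟨n, i⟩) else 1),
    ← Finset.prod_filter]
  refine Finset.prod_congr ?_ fun _ _ => rfl
  ext ⟨n, i⟩
  simp only [Finset.mem_filter, Finset.mem_sigma, Finset.mem_range, Finset.mem_univ, and_true]
  exact ⟨fun h => h.2, fun h => ⟨hN _ h, h⟩⟩

variable {X : Type*} [MeasurableSpace X] {μ : Measure X} [IsProbabilityMeasure μ]
  {A : Type*} [Finite A] [MeasurableSpace A] [DiscreteMeasurableSpace A]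

/-- A sequence of functions whose rows `f n, f n ∘ T, …` form an independent array. -/
theorem IsAperiodic.exists_seq_row {T : X ≃ᵐ X} (hap : IsAperiodic T μ) (hT : Ergodic T μ)
    (p : ℕ → Measure A) [∀ n, IsProbabilityMeasure (p n)] (d : ℕ → ℕ) :
    ∃ f : ℕ → X → A, (∀ n, Measurable (f n)) ∧ ∀ (N : ℕ) (B : ℕ → ℕ → Set A),
      μ {x | ∀ n < N, ∀ i < d n, f n (T^[i] x) ∈ B n i} =
        ∏ n ∈ Finset.range N, ∏ i ∈ Finset.range (d n), p n (B n i) := by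
  obtain ⟨f, hf⟩ := exists_seq_of_forall_exists (F := {f : X → A // Measurable f})
    (fun n u v => ∀ (D : Set ((m : Fin n) → Fin (d m) → A)) (B : ℕ → Set A),
      μ ((fun x (m : Fin n) (i : Fin (d m)) => (u m).1 (T^[i] x)) ⁻¹' D ∩ {x | ∀ i < d n, v.1 (T^[i] x) ∈ B i}) =
        μ ((fun x (m : Fin n) (i : Fin (d m)) => (u m).1 (T^[i] x)) ⁻¹' D) * ∏ i ∈ Finset.range (d n), p n (B i)) (by
    intro n u
    obtain ⟨v, hv, h⟩ := hap.exists_iid_row hT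
      (Q := fun x (m : Fin n) (i : Fin (d m)) => (u m).1 (T^[i] x))
      (measurable_pi_lambda _ fun m => measurable_pi_lambda _ fun i =>
        (u m).2.comp (T.measurable.iterate i)) (p n) (d n)
    exact ⟨⟨v, hv⟩, h⟩)
  refine ⟨fun n => (f n).1, fun n => (f n).2, fun N B => ?_⟩
  induction N with
  | zero => simp
  | succ N ih =>
    have h := hf N {c | ∀ (m : Fin N) (i : Fin (d m)), c m i ∈ B m i} (B N)
    have hpre : (fun x (m : Fin N) (i : Fin (d m)) => (f m).1 (T^[i] x)) ⁻¹'
        {c | ∀ (m : Fin N) (i : Fin (d m)), c m i ∈ B m i} =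
        {x | ∀ n < N, ∀ i < d n, (f n).1 (T^[i] x) ∈ B n i} := by
      ext x
      exact ⟨fun h n hn i hi => h ⟨n, hn⟩ ⟨i, hi⟩, fun h m i => h m m.2 i i.2⟩
    rw [hpre, ih] at h
    rw [Finset.prod_range_succ, ← h]
    congr 1
    ext x
    simp only [Set.mem_inter_iff, Set.mem_ofPred_eq, Nat.lt_succ_iff_lt_or_eq, or_imp, forall_and,
      forall_eq]

end Array

end TriangularRealization

theorem mainTheorem3
    {X : Type*} [MeasurableSpace X] (μ : Measure X) [IsProbabilityMeasure μ]
    (T : X ≃ᵐ X) (hT : Ergodic T μ) (hap : TriangularRealization.IsAperiodic T μ)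
    {A : Type*} [Finite A] [Nonempty A] [MeasurableSpace A] [DiscreteMeasurableSpace A]
    {Ω : Type*} [MeasurableSpace Ω] (P : Measure Ω) [IsProbabilityMeasure P]
    (d : ℕ → ℕ) (Y : (n : ℕ) → Fin (d n) → Ω → A)
    (hY : TriangularRealization.IsTriangularArray P d Y) :
    ∃ f : ℕ → X → A, (∀ n, Measurable (f n)) ∧
      IdentDistrib (fun x (p : Σ n, Fin (d n)) => f p.1 (T^[p.2] x))
        (fun ω (p : Σ n, Fin (d n)) => Y p.1 p.2 ω) μ P := by
  have hrow : ∀ n, ∃ p : Measure A, IsProbabilityMeasure p ∧ ∀ i, P.map (Y n i) = p := by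
    intro n
    by_cases hn : 0 < d n
    · exact ⟨P.map (Y n ⟨0, hn⟩),
        Measure.isProbabilityMeasure_map (hY.measurable n _).aemeasurable,
        fun i => (hY.identDistrib n i _).map_eq⟩
    -- An empty row constrains nothing, so any law will do.
    · exact ⟨Measure.dirac (Classical.arbitrary A), inferInstance,
        fun i => absurd (i.1.zero_le.trans_lt i.2) hn⟩
  choose p hp hpY using hrow
  obtain ⟨f, hf, h⟩ := hap.exists_seq_row hT p d
  have hYm : ∀ q : Σ n, Fin (d n), Measurable (Y q.1 q.2) := fun q => hY.measurable q.1 q.2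
  have hfm : Measurable fun x (q : Σ n, Fin (d n)) => f q.1 (T^[q.2] x) :=
    measurable_pi_lambda _ fun q => (hf q.1).comp (T.measurable.iterate q.2)
  refine ⟨f, hf, hfm.aemeasurable,
    (measurable_pi_lambda _ hYm).aemeasurable, ?_⟩
  rw [TriangularRealization.map_array_eq_infinitePi p d hf h, hY.indep.map_fun_eq_infinitePi_map hYm]
  simp_rw [hpY]
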